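/- Let $(R,\mathfrak m)$ be a commutative Noetherian local ring which is analytically unramified, that is, its $\mathfrak m$-adic completion is reduced. Let $\overline R$ be the integral closure of $R$ in its total ring of fractions, and let $\mathfrak C=\operatorname{Ann}_R(\overline R/R)$ be the conductor ideal. Suppose that 1. $\dim R=2$; 2. $\operatorname{Gdim}_R(\mathfrak C)<\infty$, that is, there is an exact sequence $0\to G_n\to\cdots\to G_0\to\mathfrak C\to 0$ for some $n\ge 0$ with every $G_i$ totally reflexive (a finitely generated $R$-module $G$ is totally reflexive if the natural map $G\to G^{**}$ is an isomorphism and $\operatorname{Ext}^i_R(G,R)=\operatorname{Ext}^i_R(G^*,R)=0$ for all $i>0$, where $(-)^*=\operatorname{Hom}_R(-,R)$); 3. the $R$-module $\overline R$ is reflexive, that is, the natural map $\overline R\to\overline R^{**}$ is an isomorphism. Then $R$ is quasi-normal, that is, it satisfies - $(S_2)$: $\operatorname{depth}(R_{\mathfrak p})\ge\min\{2,\operatorname{ht}\mathfrak p\}$ for every prime ideal $\mathfrak p$ of $R$; and - $(G_1)$: $R_{\mathfrak p}$ is Gorenstein for every prime ideal $\mathfrak p$ of $R$ of height at most $1$.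 -/

import Mathlib

universe u

open CategoryTheory

noncomputable section

/-- The normalization of `R`: the integral closure of `R` in its total ring of fractions (the
localization of `R` at the set of all its non-zero-divisors). -/
abbrev Normalization (R : Type u) [CommRing R] : Subalgebra R (FractionRing R) :=
  integralClosure R (FractionRing R)

/-- The conductor ideal: the annihilator of the `R`-module `Normalization R / R`. -/
def conductorIdeal (R : Type u) [CommRing R] : Ideal R :=
  Module.annihilator R
    (Normalization R ⧸ LinearMap.range (Algebra.linearMap R (Normalization R)))

/-- A local ring is analytically unramified if its completion in the topology of the maximal
ideal is reduced. -/
def IsAnalyticallyUnramified (R : Type u) [CommRing R] [IsLocalRing R] : Prop :=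
  IsReduced (AdicCompletion (IsLocalRing.maximalIdeal R) R)

/-- The depth of a local ring: the supremum of the lengths of the regular sequences in the
maximal ideal. -/
def localRingDepth (R : Type u) [CommRing R] [IsLocalRing R] : ℕ∞ :=
  ⨆ (rs : List R) (_ : (∀ r ∈ rs, r ∈ IsLocalRing.maximalIdeal R) ∧
    RingTheory.Sequence.IsRegular R rs), (rs.length : ℕ∞)

/-- Serre's condition `(S_n)`: the depth of the localization at any prime `p` is at least
`min n (height p)`. -/
def SatisfiesSerreS (n : ℕ) (R : Type u) [CommRing R] : Prop :=
  ∀ (p : Ideal R) [p.IsPrime],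
    min (n : ℕ∞) p.height ≤ localRingDepth (Localization.AtPrime p)

/-- A Gorenstein local ring: a Noetherian local ring that has finite injective dimension as a
module over itself. -/
structure IsGorensteinLocalRing (R : Type u) [CommRing R] : Prop where
  isNoetherianRing : IsNoetherianRing R
  isLocalRing : IsLocalRing R
  exists_hasInjectiveDimensionLE : ∃ n : ℕ, HasInjectiveDimensionLE (ModuleCat.of R R) n

/-- The condition `(G_n)`: the localization at any prime of height at most `n` is Gorenstein. -/
def SatisfiesG (n : ℕ) (R : Type u) [CommRing R] : Prop :=
  ∀ (p : Ideal R) [p.IsPrime], p.height ≤ (n : ℕ∞) →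
    IsGorensteinLocalRing (Localization.AtPrime p)

/-- A ring is quasi-normal if it satisfies `(S_2)` and `(G_1)`. -/
structure IsQuasiNormal (R : Type u) [CommRing R] : Prop where
  serreS_two : SatisfiesSerreS 2 R
  g_one : SatisfiesG 1 R

/-- A totally reflexive module: a finitely generated reflexive module `M` such that
`Ext^i(M, R) = 0` and `Ext^i(M^*, R) = 0` for all `i > 0`. -/
structure IsTotallyReflexive (R : Type u) [CommRing R] (M : Type u) [AddCommGroup M]
    [Module R M] : Prop where
  finite : Module.Finite R M
  isReflexive : Module.IsReflexive R M
  ext_eq_zero : ∀ i : ℕ, 0 < i →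
    Subsingleton (Abelian.Ext (ModuleCat.of R M) (ModuleCat.of R R) i)
  ext_dual_eq_zero : ∀ i : ℕ, 0 < i →
    Subsingleton (Abelian.Ext (ModuleCat.of R (Module.Dual R M)) (ModuleCat.of R R) i)

/-- `HasGDimensionLE R n M`: there is an exact sequence
`0 → G_n → ⋯ → G_1 → G_0 → M → 0` with all `G_i` totally reflexive, given by splicing short
exact sequences `0 → K → G → M → 0`. -/
def HasGDimensionLE (R : Type u) [CommRing R] : ℕ → ModuleCat.{u} R → Prop
  | 0, M => IsTotallyReflexive R M
  | n + 1, M => ∃ (K G : ModuleCat.{u} R) (f : K →ₗ[R] G) (g : G →ₗ[R] M),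
      Function.Injective f ∧ Function.Exact f g ∧ Function.Surjective g ∧
      IsTotallyReflexive R G ∧ HasGDimensionLE R n K

/-- The G-dimension: the least length of a resolution by totally reflexive modules, and `⊤` if
there is none (the zero module gets the value `0` here). -/
def gDimension (R : Type u) [CommRing R] (M : Type u) [AddCommGroup M] [Module R M] : ℕ∞ :=
  ⨅ (n : ℕ) (_ : HasGDimensionLE R n (ModuleCat.of R M)), (n : ℕ∞)

theorem gDimension_lt_top_iff (R : Type u) [CommRing R] (M : Type u) [AddCommGroup M]
    [Module R M] :
    gDimension R M < ⊤ ↔ ∃ n : ℕ, HasGDimensionLE R n (ModuleCat.of R M) := by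
  simp [gDimension, iInf_lt_iff]

end

/-!
Let `C` be the conductor of `R` in its normalization `B`. Then `C ≅ B*`, so reflexivity of `B`
gives `B ≅ C*`, and `B` is finite over `R`.

Let `x` be a nonzerodivisor and `P = (xB : c)` a prime of `B` associated to `B / xB`, lying over
the prime `p` of `R`. The fraction `y = c / x` is not in `B` but `yP ⊆ B`; since `B` is integrally
closed, `yP ⊄ P`, so `P` becomes invertible after inverting some `s ∉ p`. Up to `s`, the submodule
`PC` of `C` is then a direct summand of `C × C`, hence `s` kills `Ext^i_R(C / PC, R)` for all
large `i`. As `C / PC` localizes at `p` to a nonzero vector space over the residue field of `R_p`,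
high `Ext` groups of that residue field into `R_p` vanish, and `R_p` is Gorenstein. Every `p` of
height one is the contraction of such a `P`.

For depth at the maximal ideal `m`, suppose that no element of `m` is regular on `R / xR`, that is,
that `m` is associated to `R / xR`. Then `C` is totally reflexive, so that
`B / xB ≅ Hom(C, R / xR)` also has `m` as an associated prime, and the argument above gives
`Ext^i(k, R) = 0` for all `i > 1`, which forces `dim R ≤ 1`.
-/

section Ext

open Abelian

variable {R : Type u} [CommRing R]

/-- `Ext^i_R(M, N)`, for modules in the universe of the ring. -/
abbrev ExtMod (R : Type u) [CommRing R] (M N : Type u) [AddCommGroup M] [Module R M]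
    [AddCommGroup N] [Module R N] (i : ℕ) : Type u :=
  Ext (ModuleCat.of R M) (ModuleCat.of R N) i

namespace ExtMod

variable {X₁ X₂ X₃ Y : Type u} [AddCommGroup X₁] [Module R X₁] [AddCommGroup X₂] [Module R X₂]
  [AddCommGroup X₃] [Module R X₃] [AddCommGroup Y] [Module R Y]

/-- The map `Ext^i(X₂, Y) → Ext^i(X₁, Y)` induced by a linear map `X₁ → X₂`. -/
noncomputable def precomp (Y : Type u) [AddCommGroup Y] [Module R Y] (f : X₁ →ₗ[R] X₂) (i : ℕ)
    (e : ExtMod R X₂ Y i) : ExtMod R X₁ Y i :=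
  (Ext.mk₀ (ModuleCat.ofHom f)).comp e (zero_add i)

theorem precomp_zero (f : X₁ →ₗ[R] X₂) (i : ℕ) : precomp Y f i 0 = 0 :=
  Ext.comp_zero ..

theorem precomp_comp (f : X₁ →ₗ[R] X₂) (g : X₂ →ₗ[R] X₃) (i : ℕ) (e : ExtMod R X₃ Y i) :
    precomp Y (g ∘ₗ f) i e = precomp Y f i (precomp Y g i e) := by
  simp only [precomp, ModuleCat.ofHom_comp]
  rw [Ext.mk₀_comp_mk₀_assoc]

theorem precomp_smul_id (s : R) (i : ℕ) (e : ExtMod R X₁ Y i) :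
    precomp Y (s • LinearMap.id) i e = s • e := by
  have : ModuleCat.ofHom (s • (LinearMap.id : X₁ →ₗ[R] X₁)) = s • 𝟙 (ModuleCat.of R X₁) := rfl
  simp [precomp, this, Ext.mk₀_smul]

theorem smul_eq_zero_of_factors {f : X₁ →ₗ[R] X₂} {g : X₂ →ₗ[R] X₁} {s : R}
    (h : g ∘ₗ f = s • LinearMap.id) (i : ℕ) [Subsingleton (ExtMod R X₂ Y i)]
    (e : ExtMod R X₁ Y i) : s • e = 0 := by
  rw [← precomp_smul_id, ← h, precomp_comp, Subsingleton.elim (precomp Y g i e) 0, precomp_zero]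

theorem subsingleton_of_retract {f : X₁ →ₗ[R] X₂} {g : X₂ →ₗ[R] X₁}
    (h : g ∘ₗ f = LinearMap.id) (i : ℕ) [Subsingleton (ExtMod R X₂ Y i)] :
    Subsingleton (ExtMod R X₁ Y i) :=
  subsingleton_of_forall_eq 0 fun e ↦ by
    simpa using smul_eq_zero_of_factors (s := 1) (by simpa using h) i e

theorem subsingleton_of_equiv (f : X₁ ≃ₗ[R] X₂) (i : ℕ) [Subsingleton (ExtMod R X₂ Y i)] :
    Subsingleton (ExtMod R X₁ Y i) :=
  subsingleton_of_retract f.symm_comp i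

theorem subsingleton_of_subsingleton [Subsingleton X₁] (i : ℕ) :
    Subsingleton (ExtMod R X₁ Y i) :=
  subsingleton_of_forall_eq 0 fun e ↦ by
    rw [← one_smul R e, ← precomp_smul_id, Subsingleton.elim (1 • LinearMap.id) (0 : X₁ →ₗ[R] X₁)]
    simp [precomp]

theorem subsingleton_of_projective [Module.Projective R X₁] (i : ℕ) :
    Subsingleton (ExtMod R X₁ Y (i + 1)) :=
  have : Projective (ModuleCat.of R X₁) := (IsProjective.iff_projective X₁).mp inferInstance
  subsingleton_of_forall_eq 0 Ext.eq_zero_of_projective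

section ShortExact

variable {f : X₁ →ₗ[R] X₂} {g : X₂ →ₗ[R] X₃}

theorem shortExact (hf : Function.Injective f) (hfg : Function.Exact f g)
    (hg : Function.Surjective g) :
    (ModuleCat.shortComplexOfCompEqZero f g hfg.linearMap_comp_eq_zero).ShortExact :=
  ModuleCat.shortComplex_shortExact _ hfg hf hg

variable (hf : Function.Injective f) (hfg : Function.Exact f g) (hg : Function.Surjective g)

include hf hfg hg

theorem exists_comp_eq [Subsingleton (ExtMod R Y X₁ 1)] (h : Y →ₗ[R] X₃) :
    ∃ h' : Y →ₗ[R] X₂, g ∘ₗ h' = h := by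
  obtain ⟨e, he⟩ := Ext.covariant_sequence_exact₃ (ModuleCat.of R Y) (shortExact hf hfg hg)
    (Ext.mk₀ (ModuleCat.ofHom h)) (zero_add 1) (Subsingleton.elim (α := ExtMod R Y X₁ 1) _ _)
  obtain ⟨φ, rfl⟩ := (Ext.mk₀_bijective _ _).2 e
  rw [Ext.mk₀_comp_mk₀] at he
  exact ⟨φ.hom, congrArg ModuleCat.Hom.hom ((Ext.mk₀_bijective _ _).1 he)⟩

theorem exists_comp_eq_smul {s : R} (hs : ∀ e : ExtMod R X₃ Y 1, s • e = 0) (h : X₁ →ₗ[R] Y) :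
    ∃ h' : X₂ →ₗ[R] Y, h' ∘ₗ f = s • h := by
  obtain ⟨e, he⟩ := Ext.contravariant_sequence_exact₁ (shortExact hf hfg hg) (ModuleCat.of R Y)
    (s • Ext.mk₀ (ModuleCat.ofHom h)) (add_zero 1) (by rw [Ext.comp_smul]; exact hs _)
  obtain ⟨φ, rfl⟩ := (Ext.mk₀_bijective _ _).2 e
  rw [Ext.mk₀_comp_mk₀, ← Ext.mk₀_smul] at he
  exact ⟨φ.hom, congrArg ModuleCat.Hom.hom ((Ext.mk₀_bijective _ _).1 he)⟩

theorem exists_extension [Subsingleton (ExtMod R X₃ Y 1)] (h : X₁ →ₗ[R] Y) :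
    ∃ h' : X₂ →ₗ[R] Y, h' ∘ₗ f = h := by
  simpa using exists_comp_eq_smul hf hfg hg (s := 1) (fun _ ↦ Subsingleton.elim _ _) h

theorem subsingleton_one_of_exists_extension [Subsingleton (ExtMod R X₂ Y 1)]
    (H : ∀ h : X₁ →ₗ[R] Y, ∃ h' : X₂ →ₗ[R] Y, h' ∘ₗ f = h) : Subsingleton (ExtMod R X₃ Y 1) := by
  have hS := shortExact hf hfg hg
  refine subsingleton_of_forall_eq 0 fun e ↦ ?_
  obtain ⟨e', rfl⟩ := Ext.contravariant_sequence_exact₃ hS (ModuleCat.of R Y) e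
    (Subsingleton.elim (α := ExtMod R X₂ Y 1) _ _) (add_zero 1)
  obtain ⟨φ, rfl⟩ := (Ext.mk₀_bijective _ _).2 e'
  obtain ⟨h', hh'⟩ := H φ.hom
  have : φ = ModuleCat.ofHom f ≫ ModuleCat.ofHom h' := ModuleCat.hom_ext hh'.symm
  rw [this, ← Ext.mk₀_comp_mk₀]
  exact hS.extClass_comp_assoc _

theorem subsingleton_X₂ (i : ℕ) [Subsingleton (ExtMod R X₁ Y i)]
    [Subsingleton (ExtMod R X₃ Y i)] : Subsingleton (ExtMod R X₂ Y i) := by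
  refine subsingleton_of_forall_eq 0 fun e ↦ ?_
  obtain ⟨e', rfl⟩ := Ext.contravariant_sequence_exact₂ (shortExact hf hfg hg) (ModuleCat.of R Y) e
    (Subsingleton.elim (α := ExtMod R X₁ Y i) _ _)
  rw [Subsingleton.elim (α := ExtMod R X₃ Y i) e' 0, Ext.comp_zero]

theorem smul_eq_zero_X₃ (i : ℕ) {s : R} (hs : ∀ e : ExtMod R X₁ Y i, s • e = 0)
    [Subsingleton (ExtMod R X₂ Y (i + 1))] (e : ExtMod R X₃ Y (i + 1)) : s • e = 0 := by
  obtain ⟨e', rfl⟩ := Ext.contravariant_sequence_exact₃ (shortExact hf hfg hg) (ModuleCat.of R Y) e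
    (Subsingleton.elim (α := ExtMod R X₂ Y (i + 1)) _ _) (add_comm 1 i)
  rw [← Ext.comp_smul, hs e', Ext.comp_zero]

theorem subsingleton_X₃ (i : ℕ) [Subsingleton (ExtMod R X₁ Y i)]
    [Subsingleton (ExtMod R X₂ Y (i + 1))] : Subsingleton (ExtMod R X₃ Y (i + 1)) :=
  subsingleton_of_forall_eq 0 fun e ↦ by
    simpa using smul_eq_zero_X₃ hf hfg hg i (s := 1) (fun _ ↦ Subsingleton.elim _ _) e

theorem smul_eq_zero_X₁ (i : ℕ) {s : R} (hs : ∀ e : ExtMod R X₃ Y (i + 1), s • e = 0)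
    [Subsingleton (ExtMod R X₂ Y i)] (e : ExtMod R X₁ Y i) : s • e = 0 := by
  obtain ⟨e', he'⟩ := Ext.contravariant_sequence_exact₁ (shortExact hf hfg hg) (ModuleCat.of R Y)
    (s • e) (add_comm 1 i) (by rw [Ext.comp_smul]; exact hs _)
  rw [← he', Subsingleton.elim (α := ExtMod R X₂ Y i) e' 0, Ext.comp_zero]

theorem subsingleton_X₁ (i : ℕ) [Subsingleton (ExtMod R X₃ Y (i + 1))]
    [Subsingleton (ExtMod R X₂ Y i)] : Subsingleton (ExtMod R X₁ Y i) :=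
  subsingleton_of_forall_eq 0 fun e ↦ by
    simpa using smul_eq_zero_X₁ hf hfg hg i (s := 1) (fun _ ↦ Subsingleton.elim _ _) e

theorem exists_precomp_eq (i : ℕ) [Subsingleton (ExtMod R X₃ Y (i + 1))] (e : ExtMod R X₁ Y i) :
    ∃ e' : ExtMod R X₂ Y i, precomp Y f i e' = e :=
  Ext.contravariant_sequence_exact₁ (shortExact hf hfg hg) (ModuleCat.of R Y) e (add_comm 1 i)
    (Subsingleton.elim (α := ExtMod R X₃ Y (i + 1)) _ _)

end ShortExact

theorem subsingleton_prod (i : ℕ) [Subsingleton (ExtMod R X₁ Y i)]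
    [Subsingleton (ExtMod R X₂ Y i)] : Subsingleton (ExtMod R (X₁ × X₂) Y i) :=
  subsingleton_X₂ LinearMap.inl_injective Function.Exact.inl_snd LinearMap.snd_surjective i

end ExtMod

end Ext

section AssociatedPrimes

open IsLocalRing

variable {R : Type u} [CommRing R] {M N : Type*} [AddCommGroup M] [Module R M] [AddCommGroup N]
  [Module R N]

theorem exists_surjective_residueField [IsLocalRing R] (M : Type*) [AddCommGroup M] [Module R M]
    [Module.Finite R M] [Nontrivial M] :
    ∃ g : M →ₗ[R] R ⧸ maximalIdeal R, Function.Surjective g := by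
  obtain ⟨P, hP⟩ := IsCoatomic.exists_coatom (Submodule R M)
  obtain ⟨I, hI, ⟨e⟩⟩ := isSimpleModule_iff_quot_maximal.mp (isSimpleModule_iff_isCoatom.mpr hP)
  obtain rfl := eq_maximalIdeal hI
  exact ⟨e.toLinearMap ∘ₗ P.mkQ, e.surjective.comp P.mkQ_surjective⟩

theorem maximalIdeal_mem_associatedPrimes_linearMap [IsLocalRing R] [IsNoetherianRing R]
    [Module.Finite R M] [Nontrivial M] (hN : maximalIdeal R ∈ associatedPrimes R N) :
    maximalIdeal R ∈ associatedPrimes R (M →ₗ[R] N) := by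
  obtain ⟨hm, j, hj⟩ := (isAssociatedPrime_iff_exists_injective_linearMap _ _).mp hN
  obtain ⟨g, hg⟩ := exists_surjective_residueField (R := R) M
  have hmul : Function.Injective ((LinearMap.mul R (R ⧸ maximalIdeal R)).compr₂ j) :=
    fun a b hab ↦ hj (by simpa using LinearMap.congr_fun hab 1)
  exact (isAssociatedPrime_iff_exists_injective_linearMap _ _).mpr
    ⟨hm, LinearMap.lcomp R N g ∘ₗ _, (LinearMap.lcomp_injective_of_surjective g hg).comp hmul⟩

theorem exists_isSMulRegular_or_maximalIdeal_mem_associatedPrimes (R : Type*) [CommRing R]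
    [IsLocalRing R] [IsNoetherianRing R] (N : Type*) [AddCommGroup N] [Module R N]
    [Module.Finite R N] :
    (∃ y ∈ maximalIdeal R, IsSMulRegular N y) ∨ maximalIdeal R ∈ associatedPrimes R N := by
  by_contra! ⟨hreg, hass⟩
  have hle : (maximalIdeal R : Set R) ⊆ ⋃ p ∈ associatedPrimes R N, p := by
    rw [biUnion_associatedPrimes_eq_compl_regular]
    exact hreg
  obtain ⟨p, hp, hmp⟩ := (Ideal.subset_union_prime_finite (associatedPrimes.finite R N)
    (f := id) ⊥ ⊥ fun p hp _ _ ↦ hp.isPrime).mp hle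
  have := hp.isPrime
  exact hass ((maximalIdeal.isMaximal R).eq_of_le this.ne_top hmp ▸ hp)

end AssociatedPrimes

section HomQuotient

open ExtMod
open scoped Pointwise

variable {R : Type u} [CommRing R] {x : R}

theorem comp_mkQ_smul_top_eq_zero_iff {N E : Type*} [AddCommGroup N] [Module R N] [AddCommGroup E]
    [Module R E] (hx : IsSMulRegular E x) {φ : N →ₗ[R] E} :
    (x • ⊤ : Submodule R E).mkQ ∘ₗ φ = 0 ↔ ∃ ψ : N →ₗ[R] E, φ = x • ψ := by
  constructor
  · intro hφ
    have hmem (n : N) : φ n ∈ LinearMap.range (LinearMap.lsmul R E x) :=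
      (LinearMap.exact_lsmul_mkQ_smul_top E x _).mp (LinearMap.congr_fun hφ n)
    let e := LinearEquiv.ofInjective (LinearMap.lsmul R E x) hx
    refine ⟨e.symm.toLinearMap ∘ₗ φ.codRestrict _ hmem, LinearMap.ext fun n ↦ ?_⟩
    exact (congrArg Subtype.val (e.apply_symm_apply ⟨φ n, hmem n⟩)).symm
  · rintro ⟨ψ, rfl⟩
    exact LinearMap.ext fun n ↦ (LinearMap.exact_lsmul_mkQ_smul_top E x _).mpr ⟨ψ n, rfl⟩

variable {N E : Type u} [AddCommGroup N] [Module R N] [AddCommGroup E] [Module R E]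

theorem exists_mkQ_smul_top_comp_eq (hx : IsSMulRegular E x) [Subsingleton (ExtMod R N E 1)]
    (φ : N →ₗ[R] QuotSMulTop x E) :
    ∃ Φ : N →ₗ[R] E, (x • ⊤ : Submodule R E).mkQ ∘ₗ Φ = φ :=
  exists_comp_eq (f := LinearMap.lsmul R E x) hx (LinearMap.exact_lsmul_mkQ_smul_top E x)
    (Submodule.mkQ_surjective _) φ

/-- Reduction modulo an `E`-regular element `x` identifies `Hom(N, E) / x Hom(N, E)` with
`Hom(N, E / xE)` when `Ext^1(N, E) = 0`. -/
noncomputable def linearMapQuotSMulTopEquiv (hx : IsSMulRegular E x)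
    [Subsingleton (ExtMod R N E 1)] :
    QuotSMulTop x (N →ₗ[R] E) ≃ₗ[R] (N →ₗ[R] QuotSMulTop x E) :=
  let π : (N →ₗ[R] E) →ₗ[R] N →ₗ[R] QuotSMulTop x E :=
    LinearMap.compRight R (x • ⊤ : Submodule R E).mkQ
  have hπ : LinearMap.ker π = x • ⊤ := by
    ext φ
    exact (comp_mkQ_smul_top_eq_zero_iff hx).trans
      (by simp [Submodule.mem_smul_pointwise_iff_exists, eq_comm])
  Submodule.quotEquivOfEq _ _ hπ.symm ≪≫ₗ
    π.quotKerEquivOfSurjective (exists_mkQ_smul_top_comp_eq hx)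

end HomQuotient

section TotallyReflexive

open ExtMod IsLocalRing

variable {R : Type u} [CommRing R]

theorem HasGDimensionLE.subsingleton_ext {n : ℕ} {M : ModuleCat.{u} R}
    (h : HasGDimensionLE R n M) {i : ℕ} (hi : n < i) : Subsingleton (ExtMod R M R i) := by
  induction n generalizing M i with
  | zero => exact h.ext_eq_zero i hi
  | succ n ih =>
    obtain ⟨K, G, f, g, hf, hfg, hg, hG, hK⟩ := h
    obtain ⟨i, rfl⟩ := Nat.exists_eq_succ_of_ne_zero (Nat.ne_zero_of_lt hi)
    have := ih hK (Nat.lt_of_succ_lt_succ hi)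
    have : Subsingleton (ExtMod R G R (i + 1)) := hG.ext_eq_zero _ i.succ_pos
    exact subsingleton_X₃ hf hfg hg i

theorem isSMulRegular_linearMap {N E : Type*} [AddCommGroup N] [Module R N] [AddCommGroup E]
    [Module R E] {x : R} (hx : IsSMulRegular E x) : IsSMulRegular (N →ₗ[R] E) x :=
  fun _ _ h ↦ LinearMap.ext fun n ↦ hx (LinearMap.congr_fun h n)

theorem isSMulRegular_of_isReflexive {x : R} (hx : IsSMulRegular R x) (N : Type*) [AddCommGroup N]
    [Module R N] [Module.IsReflexive R N] : IsSMulRegular N x :=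
  ((Module.evalEquiv R N).isSMulRegular_congr x).mpr (isSMulRegular_linearMap hx)

section ShortExact

variable {K G M : Type u} [AddCommGroup K] [Module R K] [AddCommGroup G] [Module R G]
  [AddCommGroup M] [Module R M] {f : K →ₗ[R] G} {g : G →ₗ[R] M}

theorem isReflexive_of_exact [Module.IsReflexive R K] [Module.IsReflexive R G]
    [Subsingleton (ExtMod R (Module.Dual R K) R 1)] (hfg : Function.Exact f g)
    (hg : Function.Surjective g) (hf' : Function.Surjective f.dualMap) :
    Module.IsReflexive R M := by
  have hg' : Function.Injective g.dualMap := LinearMap.dualMap_injective_of_surjective hg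
  have hgf' : Function.Exact g.dualMap f.dualMap :=
    LinearMap.exact_lcomp_of_exact_of_surjective R hfg hg
  have hfg'' : Function.Exact f.dualMap.dualMap g.dualMap.dualMap :=
    LinearMap.exact_lcomp_of_exact_of_surjective R hgf' hf'
  exact ⟨LinearMap.bijective_of_surjective_of_bijective_of_right_exact f g f.dualMap.dualMap
    g.dualMap.dualMap (Module.Dual.eval R K) (Module.Dual.eval R G) (Module.Dual.eval R M) rfl rfl
    hfg hfg'' (Module.bijective_dual_eval R K).2 (Module.bijective_dual_eval R G) hg
    (exists_extension hg' hgf' hf')⟩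

theorem IsTotallyReflexive.of_shortExact (hK : IsTotallyReflexive R K)
    (hG : IsTotallyReflexive R G) (hf : Function.Injective f) (hfg : Function.Exact f g)
    (hg : Function.Surjective g) (hf' : Function.Surjective f.dualMap) :
    IsTotallyReflexive R M where
  finite := have := hG.finite; .of_surjective g hg
  isReflexive :=
    have := hK.isReflexive
    have := hG.isReflexive
    have : Subsingleton (ExtMod R (Module.Dual R K) R 1) := hK.ext_dual_eq_zero 1 one_pos
    isReflexive_of_exact hfg hg hf'
  ext_eq_zero := by
    rintro (_ | _ | i) hi
    · exact absurd hi (lt_irrefl 0)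
    · have : Subsingleton (ExtMod R G R 1) := hG.ext_eq_zero 1 one_pos
      exact subsingleton_one_of_exists_extension hf hfg hg hf'
    · have : Subsingleton (ExtMod R K R (i + 1)) := hK.ext_eq_zero _ i.succ_pos
      have : Subsingleton (ExtMod R G R (i + 1 + 1)) := hG.ext_eq_zero _ hi
      exact subsingleton_X₃ hf hfg hg (i + 1)
  ext_dual_eq_zero i hi := by
    have : Subsingleton (ExtMod R (Module.Dual R G) R i) := hG.ext_dual_eq_zero i hi
    have : Subsingleton (ExtMod R (Module.Dual R K) R (i + 1)) :=
      hK.ext_dual_eq_zero _ i.succ_pos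
    exact subsingleton_X₁ (LinearMap.dualMap_injective_of_surjective hg)
      (LinearMap.exact_lcomp_of_exact_of_surjective R hfg hg) hf' i

variable {x : R}

theorem eq_zero_of_comp_dualMap_eq_zero [Module.IsReflexive R K] [Module.IsReflexive R G]
    [Subsingleton (ExtMod R (Module.Dual R K) R 1)] (hf : Function.Injective f)
    (hfg : Function.Exact f g) (hx : IsSMulRegular R x) (hM : IsSMulRegular M x)
    {ψ : Module.Dual R K →ₗ[R] QuotSMulTop x R} (hψ : ψ ∘ₗ f.dualMap = 0) : ψ = 0 := by
  obtain ⟨Φ, rfl⟩ := exists_mkQ_smul_top_comp_eq hx ψ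
  obtain ⟨k, rfl⟩ := (Module.bijective_dual_eval R K).2 Φ
  obtain ⟨Φ, hΦ⟩ := (comp_mkQ_smul_top_eq_zero_iff hx (φ := Module.Dual.eval R G (f k))).mp hψ
  obtain ⟨n, rfl⟩ := (Module.bijective_dual_eval R G).2 Φ
  have hfk : f k = x • n := (Module.bijective_dual_eval R G).1 (by rw [hΦ, map_smul])
  have hgn : g n = 0 := hM.right_eq_zero_of_smul
    (by rw [← map_smul, ← hfk, hfg.apply_apply_eq_zero])
  obtain ⟨l, rfl⟩ := (hfg n).mp hgn
  have hk : k = x • l := hf (by rw [hfk, map_smul])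
  exact (comp_mkQ_smul_top_eq_zero_iff hx).mpr ⟨Module.Dual.eval R K l, by rw [hk, map_smul]⟩

variable [IsLocalRing R] [IsNoetherianRing R]

theorem IsTotallyReflexive.dualMap_surjective (hK : IsTotallyReflexive R K)
    (hG : IsTotallyReflexive R G) (hf : Function.Injective f) (hfg : Function.Exact f g)
    (hx : IsSMulRegular R x) (hxm : maximalIdeal R ∈ associatedPrimes R (QuotSMulTop x R))
    (hM : IsSMulRegular M x) : Function.Surjective f.dualMap := by
  have := hK.finite
  have := hK.isReflexive
  have := hG.isReflexive
  have : Subsingleton (ExtMod R (Module.Dual R K) R 1) := hK.ext_dual_eq_zero 1 one_pos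
  let Q := Module.Dual R K ⧸ LinearMap.range f.dualMap
  have hQ : Subsingleton (Q →ₗ[R] QuotSMulTop x R) :=
    subsingleton_of_forall_eq 0 fun φ ↦ Submodule.linearMap_qext _ <| by
      rw [LinearMap.zero_comp]
      exact eq_zero_of_comp_dualMap_eq_zero hf hfg hx hM
        (by rw [LinearMap.comp_assoc, LinearMap.range_mkQ_comp, LinearMap.comp_zero])
  by_contra hsurj
  have : Nontrivial Q :=
    Submodule.Quotient.nontrivial_iff.mpr (mt LinearMap.range_eq_top.mp hsurj)
  exact not_isAssociatedPrime_of_subsingleton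
    (maximalIdeal_mem_associatedPrimes_linearMap (M := Q) hxm)

end ShortExact

theorem HasGDimensionLE.isTotallyReflexive [IsLocalRing R] [IsNoetherianRing R] {x : R}
    (hx : IsSMulRegular R x) (hxm : maximalIdeal R ∈ associatedPrimes R (QuotSMulTop x R)) {n : ℕ}
    {M : ModuleCat.{u} R} (h : HasGDimensionLE R n M) (hM : IsSMulRegular M x) :
    IsTotallyReflexive R M := by
  induction n generalizing M with
  | zero => exact h
  | succ n ih =>
    obtain ⟨K, G, f, g, hf, hfg, hg, hG, hK⟩ := h
    have := hG.isReflexive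
    have hKx : IsSMulRegular K x :=
      (isSMulRegular_of_isReflexive hx G).of_injective f hf
    exact (ih hK hKx).of_shortExact hG hf hfg hg
      ((ih hK hKx).dualMap_surjective hG hf hfg hx hxm hM)

end TotallyReflexive

section PrimeQuotient

open ExtMod
open scoped Pointwise

variable {R : Type u} [CommRing R]

theorem isSMulRegular_quotient_of_notMem {q : Ideal R} [hq : q.IsPrime] {x : R} (hx : x ∉ q) :
    IsSMulRegular (R ⧸ q) x :=
  (isSMulRegular_quotient_iff_mem_of_smul_mem _ _).mpr fun _ ha ↦ (hq.mem_or_mem ha).resolve_left hx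

theorem annihilator_quotSMulTop_self (x : R) :
    Module.annihilator R (QuotSMulTop x R) = Ideal.span {x} := by
  have h : x • (⊤ : Ideal R) = Ideal.span {x} := by
    rw [← Submodule.ideal_span_singleton_smul, smul_eq_mul, Ideal.mul_top]
  exact (Submodule.quotEquivOfEq _ _ h).annihilator_eq.trans Ideal.annihilator_quotient

theorem mem_associatedPrimes_quotSMulTop_of_mem_minimalPrimes [IsNoetherianRing R] {x : R}
    {q : Ideal R} (hq : q ∈ (Ideal.span {x}).minimalPrimes) :
    q ∈ associatedPrimes R (QuotSMulTop x R) := by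
  apply Module.associatedPrimes.minimalPrimes_annihilator_subset_associatedPrimes
  rwa [annihilator_quotSMulTop_self]

theorem not_subsingleton_ext_one_of_mem_associatedPrimes [IsNoetherianRing R] {x : R}
    (hx : IsSMulRegular R x) {q : Ideal R} (hq : q ∈ associatedPrimes R (QuotSMulTop x R)) :
    ¬ Subsingleton (ExtMod R (R ⧸ q) R 1) := by
  intro
  have hxq : x ∈ q := hq.annihilator_le <| by
    rw [Submodule.annihilator_top, annihilator_quotSMulTop_self]
    exact Ideal.mem_span_singleton_self x
  have : Subsingleton ((R ⧸ q) →ₗ[R] R) := subsingleton_of_forall_eq 0 fun φ ↦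
    Submodule.linearMap_qext _ <| LinearMap.ext_ring <| hx.right_eq_zero_of_smul <| by
      rw [← map_smul]
      simpa using congrArg φ (Ideal.Quotient.eq_zero_iff_mem.mpr hxq)
  have : Subsingleton ((R ⧸ q) →ₗ[R] QuotSMulTop x R) :=
    (linearMapQuotSMulTopEquiv hx).symm.toEquiv.subsingleton
  have := hq.isPrime
  obtain ⟨-, f, hf⟩ := (isAssociatedPrime_iff_exists_injective_linearMap _ _).mp hq
  exact zero_ne_one (hf (by rw [Subsingleton.elim f 0]; rfl))

end PrimeQuotient

section ExtResidueField

open ExtMod IsLocalRing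

variable {R : Type u} [CommRing R] {X : Type u} [AddCommGroup X] [Module R X]

theorem subsingleton_ext_of_support [IsNoetherianRing R] {i : ℕ} (N : Type u) [AddCommGroup N]
    [Module R N] [hN : Module.Finite R N]
    (h : ∀ q ∈ Module.support R N, Subsingleton (ExtMod R (R ⧸ q.asIdeal) X i)) :
    Subsingleton (ExtMod R N X i) := by
  induction hN using IsNoetherianRing.induction_on_isQuotientEquivQuotientPrime R with
  | subsingleton N => exact subsingleton_of_subsingleton i
  | quotient N p e =>
    have hp : p ∈ Module.support R N := by
      rw [e.support_eq, Module.mem_support_iff_of_finite, Ideal.annihilator_quotient]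
    have := h p hp
    exact subsingleton_of_equiv e i
  | exact N₁ N₂ N₃ f g hf hg hfg ih₁ ih₃ =>
    have hsupp := Module.support_of_exact hfg hf hg
    have := ih₁ fun q hq ↦ h q (hsupp ▸ .inl hq)
    have := ih₃ fun q hq ↦ h q (hsupp ▸ .inr hq)
    exact subsingleton_X₂ hf hfg hg i

variable [IsLocalRing R]

theorem subsingleton_ext_residueField (V : Type u) [AddCommGroup V] [Module R V] [Module.Finite R V]
    [Nontrivial V] (hV : maximalIdeal R ≤ Module.annihilator R V) (i : ℕ)
    [Subsingleton (ExtMod R V X i)] : Subsingleton (ExtMod R (R ⧸ maximalIdeal R) X i) := by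
  obtain ⟨g, hg⟩ := exists_surjective_residueField (R := R) V
  obtain ⟨v, hv⟩ := hg 1
  let f : R ⧸ maximalIdeal R →ₗ[R] V := Submodule.liftQ _ (LinearMap.toSpanSingleton R V v)
    fun a ha ↦ Module.mem_annihilator.mp (hV ha) v
  have hgf : g ∘ₗ f = LinearMap.id := Submodule.linearMap_qext _ <| LinearMap.ext_ring <| by
    exact (congrArg g (one_smul R v)).trans hv
  exact subsingleton_of_retract hgf i

variable [IsNoetherianRing R] [Module.Finite R X]

theorem subsingleton_ext_of_isSMulRegular {M : Type u} [AddCommGroup M] [Module R M]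
    [Module.Finite R M] {x : R} (hx : x ∈ maximalIdeal R) (hxM : IsSMulRegular M x) (i : ℕ)
    [Subsingleton (ExtMod R (QuotSMulTop x M) X (i + 1))] : Subsingleton (ExtMod R M X i) := by
  have hle : (⊤ : Submodule R (ExtMod R M X i)) ≤ maximalIdeal R • ⊤ := by
    intro e _
    obtain ⟨e', rfl⟩ := exists_precomp_eq (f := LinearMap.lsmul R M x) hxM
      (LinearMap.exact_lsmul_mkQ_smul_top M x) (Submodule.mkQ_surjective _) i e
    have : precomp X (LinearMap.lsmul R M x) i e' = x • e' := precomp_smul_id x i e'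
    exact this ▸ Submodule.smul_mem_smul hx trivial
  have hbot := Submodule.eq_bot_of_le_smul_of_le_jacobson_bot (maximalIdeal R) _
    (Module.finite_def.mp inferInstance) hle (maximalIdeal_le_jacobson ⊥)
  exact (Submodule.subsingleton_iff R).mp (subsingleton_of_bot_eq_top hbot.symm)

variable {n : ℕ} (h : ∀ i, n < i → Subsingleton (ExtMod R (R ⧸ maximalIdeal R) X i))

include h

theorem subsingleton_ext_quotient_of_residueField (q : Ideal R) (hq : q.IsPrime) :
    ∀ i, n < i → Subsingleton (ExtMod R (R ⧸ q) X i) := by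
  induction q using WellFoundedGT.induction with
  | ind q ih =>
    intro i hi
    by_cases hqm : q = maximalIdeal R
    · exact hqm ▸ h i hi
    obtain ⟨x, hx, hxq⟩ := SetLike.exists_of_lt ((le_maximalIdeal hq.ne_top).lt_of_ne hqm)
    have : Subsingleton (ExtMod R (QuotSMulTop x (R ⧸ q)) X (i + 1)) :=
      subsingleton_ext_of_support _ fun p hp ↦ by
        rw [Module.support_quotSMulTop, Module.support_eq_zeroLocus,
          Ideal.annihilator_quotient] at hp
        have hxp : x ∈ p.asIdeal := by simpa using hp.2
        exact ih p.asIdeal (lt_of_le_of_ne hp.1 fun hqp ↦ hxq (hqp ▸ hxp)) p.2 (i + 1)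
          (hi.trans i.lt_succ_self)
    exact subsingleton_ext_of_isSMulRegular hx (isSMulRegular_quotient_of_notMem hxq) i

theorem subsingleton_ext_of_residueField (N : Type u) [AddCommGroup N] [Module R N]
    [Module.Finite R N] {i : ℕ} (hi : n < i) : Subsingleton (ExtMod R N X i) :=
  subsingleton_ext_of_support N fun q _ ↦
    subsingleton_ext_quotient_of_residueField h q.asIdeal q.2 i hi

end ExtResidueField

section Gorenstein

open ExtMod IsLocalRing

variable {R : Type u} [CommRing R]

theorem hasInjectiveDimensionLE_of_subsingleton_ext_quotient (n : ℕ) (X : ModuleCat.{u} R)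
    (h : ∀ I : Ideal R, Subsingleton (ExtMod R (R ⧸ I) X (n + 1))) :
    HasInjectiveDimensionLE X n := by
  induction n generalizing X with
  | zero =>
    rw [HasInjectiveDimensionLE, zero_add, ← injective_iff_hasInjectiveDimensionLT_one,
      ← Module.injective_iff_injective_object, ← Module.Baer.iff_injective]
    intro I φ
    have := h I
    obtain ⟨φ', hφ'⟩ := exists_extension (X₃ := R ⧸ I) I.subtype_injective
      (LinearMap.exact_subtype_mkQ I) (Submodule.mkQ_surjective I) φ
    exact ⟨φ', fun x hx ↦ LinearMap.congr_fun hφ' ⟨x, hx⟩⟩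
  | succ n ih =>
    obtain ⟨E, _, f, _⟩ := EnoughInjectives.presentation X
    have hf : Function.Injective f.hom := (ModuleCat.mono_iff_injective f).mp ‹_›
    have hS := shortExact hf f.hom.exact_map_mkQ_range (Submodule.mkQ_surjective _)
    refine (hS.hasInjectiveDimensionLT_X₃_iff n (by assumption)).mp
      (ih (ModuleCat.of R (E ⧸ LinearMap.range f.hom)) fun I ↦
        subsingleton_of_forall_eq 0 fun e ↦ ?_)
    obtain ⟨e', rfl⟩ := Abelian.Ext.covariant_sequence_exact₃ (ModuleCat.of R (R ⧸ I)) hS e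
      (n₁ := n + 1 + 1) rfl (Subsingleton.elim (h := h I) _ _)
    rw [Abelian.Ext.eq_zero_of_injective e', Abelian.Ext.zero_comp]

variable [IsLocalRing R] [IsNoetherianRing R]

theorem IsGorensteinLocalRing.of_subsingleton_ext_residueField {n : ℕ}
    (h : ∀ i, n < i → Subsingleton (ExtMod R (R ⧸ maximalIdeal R) R i)) :
    IsGorensteinLocalRing R where
  isNoetherianRing := inferInstance
  isLocalRing := inferInstance
  exists_hasInjectiveDimensionLE :=
    ⟨n, hasInjectiveDimensionLE_of_subsingleton_ext_quotient n _ fun I ↦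
      subsingleton_ext_of_residueField h (R ⧸ I) n.lt_succ_self⟩

theorem height_maximalIdeal_le_one {x : R} (hx : IsSMulRegular R x) (hxm : x ∈ maximalIdeal R)
    (h : ∀ i, 1 < i → Subsingleton (ExtMod R (R ⧸ maximalIdeal R) R i)) :
    (maximalIdeal R).height ≤ 1 := by
  obtain ⟨q, hq, hqm⟩ := Ideal.exists_minimalPrimes_le
    ((Ideal.span_singleton_le_iff_mem _).mpr hxm)
  have := hq.1.1
  suffices q = maximalIdeal R from
    this ▸ Ideal.height_le_one_of_isPrincipal_of_mem_minimalPrimes (Ideal.span {x}) q hq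
  by_contra hne
  obtain ⟨y, hy, hyq⟩ := SetLike.exists_of_lt (hqm.lt_of_ne hne)
  have : Subsingleton (ExtMod R (QuotSMulTop y (R ⧸ q)) R 2) :=
    subsingleton_ext_of_residueField h _ one_lt_two
  exact not_subsingleton_ext_one_of_mem_associatedPrimes hx
    (mem_associatedPrimes_quotSMulTop_of_mem_minimalPrimes hq)
    (subsingleton_ext_of_isSMulRegular hy (isSMulRegular_quotient_of_notMem hyq) 1)

end Gorenstein

section ExtLocalization

open ExtMod

variable {R : Type u} [CommRing R] [IsNoetherianRing R] (S : Submonoid R) {X Y : Type u}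
  [AddCommGroup X] [Module R X] [AddCommGroup Y] [Module R Y] [Module (Localization S) Y]
  [IsScalarTower R (Localization S) Y] (ι : X →ₗ[R] Y) [IsLocalizedModule S ι] {s : R}

include ι

theorem exists_localizedModule_extension (hs : s ∈ S) {K G : Type u} [AddCommGroup K]
    [Module R K] [Module.Finite R K] [AddCommGroup G] [Module R G] {f : K →ₗ[R] G}
    (h : ∀ ψ : K →ₗ[R] X, ∃ ψ' : G →ₗ[R] X, ψ' ∘ₗ f = s • ψ)
    (φ : LocalizedModule S K →ₗ[Localization S] Y) :
    ∃ φ' : LocalizedModule S G →ₗ[Localization S] Y, φ' ∘ₗ LocalizedModule.map S f = φ := by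
  have : Module.FinitePresentation R K := Module.finitePresentation_of_finite R K
  obtain ⟨ψ, t, hψ⟩ := Module.FinitePresentation.exists_lift_of_isLocalizedModule S ι
    (φ.restrictScalars R ∘ₗ LocalizedModule.mkLinearMap S K)
  obtain ⟨ψ', hψ'⟩ := h ψ
  let Φ := IsLocalizedModule.mapExtendScalars S (LocalizedModule.mkLinearMap S G) ι
    (Localization S) ψ'
  have hΦ : Φ ∘ₗ LocalizedModule.map S f = algebraMap R (Localization S) (s * t) • φ := by
    refine LinearMap.restrictScalars_injective R <| IsLocalizedModule.ext S
      (LocalizedModule.mkLinearMap S K) (IsLocalizedModule.map_units ι) <| LinearMap.ext fun k ↦ ?_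
    calc Φ (LocalizedModule.map S f (LocalizedModule.mkLinearMap S K k))
      _ = Φ (LocalizedModule.mkLinearMap S G (f k)) := by simp
      _ = ι (ψ' (f k)) := IsLocalizedModule.map_apply S _ _ ψ' (f k)
      _ = s • ι (ψ k) := by rw [← map_smul]; exact congrArg ι (LinearMap.congr_fun hψ' k)
      _ = s • (t : R) • φ (LocalizedModule.mkLinearMap S K k) :=
        congrArg (s • ·) (LinearMap.congr_fun hψ k)
      _ = algebraMap R (Localization S) (s * t) • φ (LocalizedModule.mkLinearMap S K k) := by
        rw [smul_smul, algebraMap_smul]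
  obtain ⟨w, hw⟩ := IsLocalization.map_units (Localization S) (⟨s, hs⟩ * t)
  refine ⟨(↑w⁻¹ : Localization S) • Φ, ?_⟩
  rw [LinearMap.smul_comp, hΦ]
  exact (congrArg (fun a ↦ (↑w⁻¹ : Localization S) • a • φ) hw.symm).trans
    (by rw [smul_smul, Units.inv_mul, one_smul])

theorem subsingleton_ext_localizedModule (hs : s ∈ S) (i : ℕ) (M : Type u) [AddCommGroup M]
    [Module R M] [Module.Finite R M] (h : ∀ e : ExtMod R M X (i + 1), s • e = 0) :
    Subsingleton (ExtMod (Localization S) (LocalizedModule S M) Y (i + 1)) := by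
  obtain ⟨n, g, hg⟩ := Module.Finite.exists_fin' R M
  let f := (LinearMap.ker g).subtype
  have hf : Function.Injective f := Submodule.injective_subtype _
  have hfg : Function.Exact f g := LinearMap.exact_subtype_ker_map g
  have hfS : Function.Injective (LocalizedModule.map S f) :=
    LocalizedModule.map_injective S f hf
  have hfgS : Function.Exact (LocalizedModule.map S f) (LocalizedModule.map S g) :=
    LocalizedModule.map_exact S f g hfg
  have hgS : Function.Surjective (LocalizedModule.map S g) :=
    LocalizedModule.map_surjective S g hg
  have : Module.Projective (Localization S) (LocalizedModule S (Fin n → R)) :=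
    Module.projective_of_isLocalizedModule S (LocalizedModule.mkLinearMap S (Fin n → R))
  have hproj (j : ℕ) : Subsingleton (ExtMod R (Fin n → R) X (j + 1)) := subsingleton_of_projective j
  have hprojS (j : ℕ) :
      Subsingleton (ExtMod (Localization S) (LocalizedModule S (Fin n → R)) Y (j + 1)) :=
    subsingleton_of_projective j
  cases i with
  | zero =>
    exact subsingleton_one_of_exists_extension hfS hfgS hgS
      (exists_localizedModule_extension S ι hs (exists_comp_eq_smul hf hfg hg h))
  | succ i =>
    have := subsingleton_ext_localizedModule hs i (LinearMap.ker g)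
      (smul_eq_zero_X₁ hf hfg hg (i + 1) h)
    exact subsingleton_X₃ (X₁ := LocalizedModule S (LinearMap.ker g)) hfS hfgS hgS (i + 1)

end ExtLocalization

section IntegralExtension

theorem isIntegral_of_mul_mem {R A : Type*} [CommRing R] [IsNoetherianRing R] [CommRing A]
    [Algebra R A] {N : Submodule R A} (hN : N.FG) {t : A} (htN : t ∈ N) (ht : IsUnit t) {y : A}
    (hy : ∀ z ∈ N, y * z ∈ N) : IsIntegral R y := by
  have : IsNoetherian R N := isNoetherian_of_fg_of_noetherian N hN
  have hmem : ∀ a ∈ Algebra.adjoin R {y}, ∀ z ∈ N, a * z ∈ N := fun a ha ↦ by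
    induction ha using Algebra.adjoin_induction with
    | mem a ha => rwa [Set.mem_singleton_iff.mp ha]
    | algebraMap r => exact fun z hz ↦ Algebra.smul_def r z ▸ N.smul_mem r hz
    | add a b _ _ ha hb => exact fun z hz ↦ add_mul a b z ▸ N.add_mem (ha z hz) (hb z hz)
    | mul a b _ _ ha hb => exact fun z hz ↦ mul_assoc a b z ▸ ha _ (hb z hz)
  let mulT : Subalgebra.toSubmodule (Algebra.adjoin R {y}) →ₗ[R] N :=
    (LinearMap.mulRight R t).restrict fun a ha ↦ hmem a ha t htN
  have hmulT : Function.Injective mulT := fun a b h ↦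
    Subtype.ext (ht.mul_right_cancel (congrArg Subtype.val h))
  exact isIntegral_of_submodule_noetherian _ (isNoetherian_of_injective mulT hmulT) y
    (Algebra.self_mem_adjoin_singleton R y)

variable {R : Type*} [CommRing R] [IsNoetherianRing R] {B : Type*} [CommRing B] [IsNoetherianRing B]
  [Algebra R B]

theorem exists_mem_associatedPrimes_comap_eq {N : Type*} [AddCommGroup N] [Module R N] [Module B N]
    [IsScalarTower R B N] {p : Ideal R} (hp : p ∈ associatedPrimes R N) :
    ∃ P ∈ associatedPrimes B N, P.comap (algebraMap R B) = p := by
  obtain ⟨hp, z, hz⟩ := isAssociatedPrime_iff.mp hp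
  have hcomap : (Module.annihilator B (Submodule.span B {z})).comap (algebraMap R B) = p := by
    ext r
    rw [hz, Ideal.mem_comap, Submodule.mem_annihilator_span_singleton, algebraMap_smul,
      Submodule.mem_colon_singleton, Submodule.mem_bot]
  obtain ⟨P, hP, rfl⟩ := Ideal.exists_minimalPrimes_comap_eq (algebraMap R B) p
    (by rw [hcomap, Ideal.minimalPrimes_eq_subsingleton_self]; rfl)
  exact ⟨P, associatedPrimes.subset_of_injective (Submodule.subtype_injective _)
    (Module.associatedPrimes.minimalPrimes_annihilator_subset_associatedPrimes B _ hP), rfl⟩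

theorem exists_mem_associatedPrimes_quotSMulTop_comap_eq_of_height_le_one [Algebra.IsIntegral R B]
    [FaithfulSMul R B] {p : Ideal R} [p.IsPrime] (hp : p.height ≤ 1) {x : R} (hxp : x ∈ p)
    (hx : x ∈ nonZeroDivisors R) :
    ∃ P ∈ associatedPrimes B (QuotSMulTop (algebraMap R B x) B), P.comap (algebraMap R B) = p := by
  obtain ⟨⟨Q, _, hQ⟩⟩ := Ideal.nonempty_primesOver (S := B) p
  have hspan : Ideal.span {x} ≤ p := (Ideal.span_singleton_le_iff_mem p).mpr hxp
  have hle : Ideal.span {x} ≤ (Ideal.span {algebraMap R B x}).comap (algebraMap R B) := by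
    rw [Ideal.span_singleton_le_iff_mem, Ideal.mem_comap]
    exact Ideal.mem_span_singleton_self _
  have hcomap : (Ideal.span {algebraMap R B x}).comap (algebraMap R B) ≤ p := by
    refine hQ.over ▸ Ideal.comap_mono ((Ideal.span_singleton_le_iff_mem Q).mpr ?_)
    rwa [← Ideal.mem_comap, ← Ideal.under_def, ← hQ.over]
  have hminimal : p ∈ (Ideal.span {x}).minimalPrimes := Ideal.mem_minimalPrimes_of_height_le hspan
    (hp.trans (Ideal.one_le_height_span_singleton_of_mem_nonZeroDivisors hx))
  obtain ⟨P, hP, rfl⟩ := Ideal.exists_minimalPrimes_comap_eq (algebraMap R B) p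
    ⟨⟨‹_›, hcomap⟩, fun q hq hqp ↦ hminimal.2 ⟨hq.1, hle.trans hq.2⟩ hqp⟩
  exact ⟨P, mem_associatedPrimes_quotSMulTop_of_mem_minimalPrimes hP, rfl⟩

end IntegralExtension

section InvertiblePrime

variable {B A : Type*} [CommRing B] [CommRing A] [Algebra B A]

theorem exists_mul_mem_mul_notMem [IsNoetherianRing B] [IsIntegrallyClosedIn B A] {x : B}
    (hx : IsUnit (algebraMap B A x)) {P : Ideal B} (hP : P ∈ associatedPrimes B (QuotSMulTop x B)) :
    ∃ y : A, (∀ a ∈ P, ∃ b, algebraMap B A b = y * algebraMap B A a) ∧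
      ∃ a ∈ P, ∃ b ∉ P, algebraMap B A b = y * algebraMap B A a := by
  obtain ⟨hP, z, hz⟩ := isAssociatedPrime_iff.mp hP
  obtain ⟨c, rfl⟩ := Submodule.Quotient.mk_surjective _ z
  have hmem (a : B) : a ∈ P ↔ x ∣ a * c := by
    rw [hz, Submodule.mem_colon_singleton, Submodule.mem_bot, ← Submodule.Quotient.mk_smul,
      Submodule.Quotient.mk_eq_zero, Submodule.mem_smul_pointwise_iff_exists]
    exact ⟨fun ⟨b, _, hb⟩ ↦ ⟨b, hb.symm⟩, fun ⟨b, hb⟩ ↦ ⟨b, trivial, hb.symm⟩⟩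
  obtain ⟨x', hx'⟩ := hx
  have hdiv (a b : B) (hab : a * c = x * b) :
      algebraMap B A b = ↑x'⁻¹ * algebraMap B A c * algebraMap B A a := by
    rw [mul_assoc, ← map_mul, mul_comm c, hab, map_mul, ← hx', Units.inv_mul_cancel_left]
  refine ⟨↑x'⁻¹ * algebraMap B A c, fun a ha ↦ ?_, ?_⟩
  · obtain ⟨b, hb⟩ := (hmem a).mp ha
    exact ⟨b, hdiv a b hb⟩
  by_contra! hstable
  have hint : IsIntegral B (↑x'⁻¹ * algebraMap B A c) := by
    refine isIntegral_of_mul_mem (N := Submodule.map (Algebra.linearMap B A) P)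
      ((IsNoetherian.noetherian P).map _) (t := algebraMap B A x)
      (Submodule.mem_map_of_mem ((hmem x).mpr (dvd_mul_right x c))) (hx' ▸ x'.isUnit) ?_
    rintro _ ⟨a, ha, rfl⟩
    obtain ⟨b, hb⟩ := (hmem a).mp ha
    exact ⟨b, by_contra fun hbP ↦ hstable a ha b hbP (hdiv a b hb), hdiv a b hb⟩
  obtain ⟨b, hb⟩ := IsIntegrallyClosedIn.algebraMap_eq_of_integral hint
  refine hP.ne_top (P.eq_top_iff_one.mpr ((hmem 1).mpr ⟨b, ?_⟩))
  apply IsIntegralClosure.algebraMap_injective B B A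
  rw [one_mul, map_mul, hb, ← hx', Units.mul_inv_cancel_left]

theorem exists_algebraMap_eq_mul_add {R : Type*} [CommRing R] [Algebra R B] [Algebra.IsIntegral R B]
    {P : Ideal B} [P.IsPrime] {y : A}
    (hy : ∃ a ∈ P, ∃ b ∉ P, algebraMap B A b = y * algebraMap B A a) :
    ∃ s ∉ P.comap (algebraMap R B), ∃ u ∈ P, ∃ v ∈ P,
      algebraMap B A (algebraMap R B s) = y * algebraMap B A u + algebraMap B A v := by
  obtain ⟨a, ha, b, hb, hab⟩ := hy
  have hlt : P.comap (algebraMap R B) < (P ⊔ Ideal.span {b}).comap (algebraMap R B) :=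
    Ideal.comap_lt_comap_of_integral_mem_sdiff le_sup_left
      ⟨Ideal.mem_sup_right (Ideal.mem_span_singleton_self b), hb⟩ (Algebra.IsIntegral.isIntegral b)
  obtain ⟨s, hs, hsP⟩ := SetLike.exists_of_lt hlt
  obtain ⟨v, hv, z, hz, hvz⟩ := Submodule.mem_sup.mp (Ideal.mem_comap.mp hs)
  obtain ⟨d, rfl⟩ := Ideal.mem_span_singleton'.mp hz
  refine ⟨s, hsP, a * d, P.mul_mem_right d ha, v, hv, ?_⟩
  rw [← hvz, map_add, map_mul, map_mul, hab]
  ring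

variable {V : Type*} [AddCommGroup V] [Module B V] [Module A V] [IsScalarTower B A V]

theorem exists_comp_eq_smul_id_of_eq_mul_add {P : Ideal B} {y : A}
    (hy : ∀ a ∈ P, ∃ b, algebraMap B A b = y * algebraMap B A a) {u v d : B} (hu : u ∈ P)
    (hv : v ∈ P) (hd : algebraMap B A d = y * algebraMap B A u + algebraMap B A v)
    (M : Submodule B V) :
    ∃ (f : (P • ⊤ : Submodule B M) →ₗ[B] M × M) (g : M × M →ₗ[B] (P • ⊤ : Submodule B M)),
      g ∘ₗ f = d • LinearMap.id := by
  have hyM (m : M) (hm : m ∈ (P • ⊤ : Submodule B M)) : y • (m : V) ∈ M := by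
    induction hm using Submodule.smul_induction_on' with
    | smul a ha m _ =>
      obtain ⟨b, hb⟩ := hy a ha
      rw [Submodule.coe_smul, ← algebraMap_smul A a, smul_smul, ← hb, algebraMap_smul]
      exact M.smul_mem b m.2
    | add a _ b _ ha hb => exact smul_add y (a : V) b ▸ M.add_mem ha hb
  let mulY : (P • ⊤ : Submodule B M) →ₗ[B] M :=
    (Algebra.lsmul B B V y ∘ₗ M.subtype ∘ₗ Submodule.subtype _).codRestrict M fun m ↦ hyM m m.2
  let mulP (a : B) (ha : a ∈ P) : M →ₗ[B] (P • ⊤ : Submodule B M) :=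
    (LinearMap.lsmul B M a).codRestrict _ fun m ↦ Submodule.smul_mem_smul ha trivial
  refine ⟨mulY.prod (Submodule.subtype _), (mulP u hu).coprod (mulP v hv),
    LinearMap.ext fun m ↦ Subtype.ext (Subtype.ext ?_)⟩
  change u • y • ((m : M) : V) + v • ((m : M) : V) = d • ((m : M) : V)
  rw [← algebraMap_smul A d, hd, add_smul, mul_smul, algebraMap_smul, algebraMap_smul,
    smul_comm]

end InvertiblePrime

section LocalizedResidueField

open ExtMod IsLocalRing

variable {R : Type u} [CommRing R]

theorem annihilator_quotient_smul_top {B M : Type*} [CommRing B] [AddCommGroup M] [Module B M]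
    [Module.Finite B M] (P : Ideal B) [P.IsPrime] (hM : Module.annihilator B M ≤ P) :
    Module.annihilator B (M ⧸ (P • ⊤ : Submodule B M)) = P := by
  have hP : (⟨P, inferInstance⟩ : PrimeSpectrum B) ∈
      Module.support B (M ⧸ (P • ⊤ : Submodule B M)) := by
    rw [Module.support_quotient]
    exact ⟨Module.mem_support_iff_of_finite.mpr hM, le_refl P⟩
  refine le_antisymm (Module.mem_support_iff_of_finite.mp hP) fun a ha ↦ ?_
  rw [Submodule.annihilator_quotient]
  exact Submodule.mem_colon.mpr fun m _ ↦ Submodule.smul_mem_smul ha trivial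

theorem maximalIdeal_le_annihilator_localizedModule (p : Ideal R) [p.IsPrime] {V : Type*}
    [AddCommGroup V] [Module R V] (hV : p ≤ Module.annihilator R V) :
    maximalIdeal (Localization.AtPrime p) ≤
      Module.annihilator (Localization.AtPrime p) (LocalizedModule p.primeCompl V) := by
  rw [← Localization.AtPrime.map_eq_maximalIdeal, Ideal.map_le_iff_le_comap]
  refine fun r hr ↦ Module.mem_annihilator.mpr fun v ↦ ?_
  induction v using LocalizedModule.induction_on with
  | _ m t =>
    rw [algebraMap_smul, LocalizedModule.smul'_mk, Module.mem_annihilator.mp (hV hr),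
      LocalizedModule.zero_mk]

theorem subsingleton_ext_residueField_localization [IsNoetherianRing R] (p : Ideal R) [p.IsPrime]
    {V : Type u} [AddCommGroup V] [Module R V] [Module.Finite R V]
    (hV : Module.annihilator R V = p) {s : R} (hs : s ∉ p) (i : ℕ)
    (h : ∀ e : ExtMod R V R (i + 1), s • e = 0) :
    Subsingleton (ExtMod (Localization.AtPrime p)
      (Localization.AtPrime p ⧸ maximalIdeal (Localization.AtPrime p)) (Localization.AtPrime p)
      (i + 1)) := by
  have : Nontrivial (LocalizedModule p.primeCompl V) :=
    Module.mem_support_iff (p := ⟨p, inferInstance⟩) |>.mp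
      (Module.mem_support_iff_of_finite.mpr hV.le)
  have := subsingleton_ext_localizedModule p.primeCompl
    (Algebra.linearMap R (Localization.AtPrime p)) hs i V h
  exact subsingleton_ext_residueField (LocalizedModule p.primeCompl V)
    (maximalIdeal_le_annihilator_localizedModule p hV.ge) (i + 1)

variable [IsNoetherianRing R] {B A : Type*} [CommRing B] [CommRing A] [Algebra R B]
  [Module.Finite R B] [Algebra B A] {V : Type u} [AddCommGroup V] [Module R V] [Module B V]
  [Module A V] [IsScalarTower R B V] [IsScalarTower B A V]

theorem exists_notMem_smul_ext_eq_zero [IsIntegrallyClosedIn B A] {x : B}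
    (hx : IsUnit (algebraMap B A x)) {P : Ideal B} (hP : P ∈ associatedPrimes B (QuotSMulTop x B))
    (M : Submodule B V) {X : Type u} [AddCommGroup X] [Module R X] {n : ℕ}
    (hM : ∀ i, n < i → Subsingleton (ExtMod R M X i)) :
    ∃ s ∉ P.comap (algebraMap R B), ∀ i, n < i →
      ∀ e : ExtMod R (M ⧸ (P • ⊤ : Submodule B M)) X (i + 1), s • e = 0 := by
  have : IsNoetherianRing B := .of_finite R B
  have : P.IsPrime := hP.isPrime
  obtain ⟨y, hy, hyP⟩ := exists_mul_mem_mul_notMem hx hP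
  obtain ⟨s, hs, u, hu, v, hv, hsy⟩ := exists_algebraMap_eq_mul_add (R := R) hyP
  obtain ⟨f, g, hgf⟩ := exists_comp_eq_smul_id_of_eq_mul_add hy hu hv hsy M
  have hgfR : g.restrictScalars R ∘ₗ f.restrictScalars R = s • LinearMap.id :=
    LinearMap.ext fun m ↦ (LinearMap.congr_fun hgf m).trans (algebraMap_smul B s m)
  refine ⟨s, hs, fun i hi ↦ ?_⟩
  have := hM i hi
  have := hM (i + 1) (hi.trans i.lt_succ_self)
  have : Subsingleton (ExtMod R (M × M) X i) := subsingleton_prod i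
  let W : Submodule B M := P • ⊤
  exact smul_eq_zero_X₃ (f := W.subtype.restrictScalars R) (g := W.mkQ.restrictScalars R)
    W.subtype_injective (LinearMap.exact_subtype_mkQ W) W.mkQ_surjective i
    (smul_eq_zero_of_factors hgfR i)

theorem subsingleton_ext_residueField_of_comap_eq [IsIntegrallyClosedIn B A] {x : B}
    (hx : IsUnit (algebraMap B A x)) {P : Ideal B} (hP : P ∈ associatedPrimes B (QuotSMulTop x B))
    {p : Ideal R} [p.IsPrime] (hp : P.comap (algebraMap R B) = p) (M : Submodule B V)
    [Module.Finite R M] (hMP : Module.annihilator B M ≤ P) {n : ℕ}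
    (hM : ∀ i, n < i → Subsingleton (ExtMod R M R i)) (i : ℕ) (hi : n + 1 < i) :
    Subsingleton (ExtMod (Localization.AtPrime p)
      (Localization.AtPrime p ⧸ maximalIdeal (Localization.AtPrime p)) (Localization.AtPrime p)
      i) := by
  obtain ⟨s, hs, hext⟩ := exists_notMem_smul_ext_eq_zero hx hP M hM
  obtain ⟨i, rfl⟩ := Nat.exists_eq_succ_of_ne_zero (Nat.ne_zero_of_lt hi)
  have : P.IsPrime := hP.isPrime
  have : Module.Finite B M := .of_restrictScalars_finite R B M
  let W : Submodule B M := P • ⊤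
  have : Module.Finite R (M ⧸ W) := .of_surjective (W.mkQ.restrictScalars R) W.mkQ_surjective
  have hann : Module.annihilator R (M ⧸ W) = p := by
    rw [← Module.comap_annihilator (R := B), annihilator_quotient_smul_top P hMP, hp]
  exact subsingleton_ext_residueField_localization p hann (hp ▸ hs) i
    (hext i (Nat.lt_of_succ_lt_succ hi))

end LocalizedResidueField

section Conductor

variable (R : Type u) [CommRing R]

theorem algebraMap_normalization_injective :
    Function.Injective (algebraMap R (Normalization R)) := fun _ _ h ↦
  IsFractionRing.injective R (FractionRing R) (congrArg Subtype.val h)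

variable {R}

theorem isUnit_algebraMap_normalization {x : R} (hx : x ∈ nonZeroDivisors R) :
    IsUnit (algebraMap (Normalization R) (FractionRing R) (algebraMap R (Normalization R) x)) :=
  IsLocalization.map_units (FractionRing R) ⟨x, hx⟩

theorem mem_conductorIdeal_iff {r : R} : r ∈ conductorIdeal R ↔
    ∀ b : Normalization R, r • b ∈ LinearMap.range (Algebra.linearMap R (Normalization R)) := by
  rw [conductorIdeal, Submodule.annihilator_quotient, Submodule.mem_colon]
  exact forall_congr' fun b ↦ forall_prop_of_true trivial

theorem algebraMap_dual_apply (B : Subalgebra R (FractionRing R)) (φ : Module.Dual R B) (b : B) :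
    algebraMap R B (φ b) = φ 1 • b := by
  obtain ⟨⟨a, s⟩, hb⟩ := IsLocalization.surj (nonZeroDivisors R) (b : FractionRing R)
  have hsb : (s : R) • b = a • (1 : B) := Subtype.ext <| by
    change (s : R) • (b : FractionRing R) = a • 1
    rw [Algebra.smul_def, Algebra.smul_def, mul_one, mul_comm, hb]
  have hsφ : (s : R) * φ b = a * φ 1 := by
    rw [← smul_eq_mul, ← smul_eq_mul, ← map_smul, hsb, map_smul]
  refine Subtype.ext ((IsLocalization.map_units (FractionRing R) s).mul_left_cancel ?_)
  calc algebraMap R (FractionRing R) s * algebraMap R (FractionRing R) (φ b)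
    _ = algebraMap R (FractionRing R) (φ 1) * algebraMap R (FractionRing R) a := by
      rw [← map_mul, hsφ, mul_comm, map_mul]
    _ = algebraMap R (FractionRing R) s * (φ 1 • (b : FractionRing R)) := by
      rw [← hb, Algebra.smul_def]
      ring

/-- Multiplication by an element `c` of the conductor, as a functional on the normalization. -/
noncomputable def conductorIdealToDual (c : conductorIdeal R) : Module.Dual R (Normalization R) :=
  (LinearEquiv.ofInjective (Algebra.linearMap R (Normalization R))
    (algebraMap_normalization_injective R)).symm.toLinearMap ∘ₗ
    (LinearMap.lsmul R (Normalization R) c).codRestrict _ (mem_conductorIdeal_iff.mp c.2)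

theorem algebraMap_conductorIdealToDual (c : conductorIdeal R) (b : Normalization R) :
    algebraMap R (Normalization R) (conductorIdealToDual c b) = (c : R) • b :=
  LinearEquiv.ofInjective_symm_apply (h := algebraMap_normalization_injective R)
    (f := Algebra.linearMap R (Normalization R))
    ⟨(c : R) • b, mem_conductorIdeal_iff.mp c.2 b⟩

variable (R) in
/-- The dual of the normalization is the conductor: a functional is multiplication by its value
at `1`. -/
noncomputable def dualNormalizationEquiv :
    Module.Dual R (Normalization R) ≃ₗ[R] conductorIdeal R where
  __ := (LinearMap.applyₗ (1 : Normalization R)).codRestrict (conductorIdeal R) fun φ ↦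
    mem_conductorIdeal_iff.mpr fun b ↦ ⟨φ b, algebraMap_dual_apply _ φ b⟩
  invFun := conductorIdealToDual
  left_inv φ := LinearMap.ext fun b ↦ algebraMap_normalization_injective R <|
    (algebraMap_conductorIdealToDual _ b).trans (algebraMap_dual_apply _ φ b).symm
  right_inv c := Subtype.ext <| algebraMap_normalization_injective R <|
    (algebraMap_conductorIdealToDual c 1).trans (Algebra.algebraMap_eq_smul_one (c : R)).symm

/-- For a reflexive normalization `B`, the isomorphism `B ≃ B** ≃ C*` with the dual of the
conductor `C ≃ B*`. -/
noncomputable def normalizationEquivDual [Module.IsReflexive R (Normalization R)] :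
    Normalization R ≃ₗ[R] Module.Dual R (conductorIdeal R) :=
  Module.evalEquiv R (Normalization R) ≪≫ₗ (dualNormalizationEquiv R).symm.dualMap

theorem finite_normalization_of_isReflexive [IsNoetherianRing R]
    [Module.IsReflexive R (Normalization R)] : Module.Finite R (Normalization R) :=
  .equiv normalizationEquivDual.symm

variable (R) in
/-- The conductor as a submodule of the total ring of fractions over the normalization. -/
def fractionalConductor : Submodule (Normalization R) (FractionRing R) where
  carrier := {z | ∀ b : Normalization R,
    b • z ∈ LinearMap.range (Algebra.linearMap R (FractionRing R))}
  add_mem' hz hw b := by rw [smul_add]; exact add_mem (hz b) (hw b)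
  zero_mem' b := by rw [smul_zero]; exact zero_mem _
  smul_mem' d _ hz b := by rw [smul_smul]; exact hz (b * d)

theorem algebraMap_mem_fractionalConductor {r : R} (hr : r ∈ conductorIdeal R) :
    algebraMap R (FractionRing R) r ∈ fractionalConductor R := by
  intro b
  obtain ⟨a, ha⟩ := mem_conductorIdeal_iff.mp hr b
  refine ⟨a, (congrArg Subtype.val ha).trans ?_⟩
  exact (Algebra.smul_def r (b : FractionRing R)).trans (mul_comm _ _)

theorem exists_mem_conductorIdeal_algebraMap_eq {z : FractionRing R}
    (hz : z ∈ fractionalConductor R) : ∃ r ∈ conductorIdeal R, algebraMap R _ r = z := by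
  obtain ⟨r, hr⟩ := hz 1
  obtain rfl : algebraMap R _ r = z := hr.trans (one_smul _ z)
  refine ⟨r, mem_conductorIdeal_iff.mpr fun b ↦ ?_, rfl⟩
  obtain ⟨a, ha⟩ := hz b
  refine ⟨a, Subtype.ext (ha.trans ?_)⟩
  exact (mul_comm _ _).trans (Algebra.smul_def r (b : FractionRing R)).symm

variable (R) in
/-- The identification of the conductor as an ideal of `R` with the conductor as a fractional ideal
of the normalization. -/
noncomputable def conductorEquiv : conductorIdeal R ≃ₗ[R] fractionalConductor R :=
  LinearEquiv.ofBijective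
    ((Algebra.linearMap R (FractionRing R)).restrict
      (q := (fractionalConductor R).restrictScalars R)
      fun _ ↦ algebraMap_mem_fractionalConductor)
    ⟨fun _ _ h ↦ Subtype.ext (IsFractionRing.injective R (FractionRing R) (congrArg Subtype.val h)),
      fun ⟨_, hz⟩ ↦
        let ⟨r, hr, hrz⟩ := exists_mem_conductorIdeal_algebraMap_eq hz
        ⟨⟨r, hr⟩, Subtype.ext hrz⟩⟩

theorem finite_fractionalConductor [IsNoetherianRing R] :
    Module.Finite R (fractionalConductor R) :=
  .equiv (conductorEquiv R)

variable [Module.Finite R (Normalization R)]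

variable (R) in
theorem exists_mem_conductorIdeal_mem_nonZeroDivisors :
    ∃ a ∈ conductorIdeal R, a ∈ nonZeroDivisors R := by
  have hfg : (Subalgebra.toSubmodule (Normalization R)).FG := Module.Finite.iff_fg.mp ‹_›
  obtain ⟨a, ha, hint⟩ := FractionalIdeal.isFractional_of_fg (S := nonZeroDivisors R) hfg
  refine ⟨a, mem_conductorIdeal_iff.mpr fun b ↦ ?_, ha⟩
  obtain ⟨r, hr⟩ := hint b b.2
  exact ⟨r, Subtype.ext hr⟩

theorem nontrivial_conductorIdeal [Nontrivial R] : Nontrivial (conductorIdeal R) :=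
  let ⟨a, haC, ha⟩ := exists_mem_conductorIdeal_mem_nonZeroDivisors R
  ⟨⟨⟨a, haC⟩, 0, fun h ↦ nonZeroDivisors.ne_zero ha (congrArg Subtype.val h)⟩⟩

theorem annihilator_fractionalConductor :
    Module.annihilator (Normalization R) (fractionalConductor R) = ⊥ := by
  obtain ⟨a, haC, ha⟩ := exists_mem_conductorIdeal_mem_nonZeroDivisors R
  refine (Submodule.eq_bot_iff _).mpr fun b hb ↦ Subtype.ext ?_
  have hba : b • algebraMap R (FractionRing R) a = 0 := congrArg Subtype.val
    (Module.mem_annihilator.mp hb ⟨_, algebraMap_mem_fractionalConductor haC⟩)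
  exact (IsLocalization.map_units (FractionRing R) ⟨a, ha⟩).mul_left_eq_zero.mp hba

end Conductor

section Reduced

open IsLocalRing

variable {R : Type u} [CommRing R]

theorem IsAnalyticallyUnramified.isReduced [IsLocalRing R] [IsNoetherianRing R]
    (hR : IsAnalyticallyUnramified R) : IsReduced R :=
  have : IsReduced (AdicCompletion (maximalIdeal R) R) := hR
  isReduced_of_injective (algebraMap R (AdicCompletion (maximalIdeal R) R))
    (AdicCompletion.of_injective (maximalIdeal R) R)

variable [IsNoetherianRing R] [IsReduced R] {p : Ideal R} [p.IsPrime]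

theorem exists_mem_nonZeroDivisors_of_height_ne_zero (hp : p.height ≠ 0) :
    ∃ x ∈ p, x ∈ nonZeroDivisors R := by
  have hnot : ¬ (p : Set R) ⊆ ⋃ q ∈ minimalPrimes R, (q : Set R) := by
    rw [Ideal.subset_union_prime_finite (f := fun q ↦ q)
      (minimalPrimes.finite_of_isNoetherianRing R) ⊥ ⊥ fun q hq _ _ ↦ hq.1.1]
    rintro ⟨q, hq, hpq⟩
    obtain rfl : q = p := (hq.2 ⟨‹_›, bot_le⟩ hpq).antisymm hpq
    exact hp (Ideal.height_eq_zero_iff.mpr hq)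
  obtain ⟨x, hxp, hx⟩ := Set.not_subset.mp hnot
  refine ⟨x, hxp, mem_nonZeroDivisors_iff_right.mpr fun y hyx ↦ ?_⟩
  suffices y ∈ nilradical R by rwa [nilradical_eq_zero] at this
  rw [nilradical, ← Ideal.sInf_minimalPrimes]
  refine Ideal.mem_sInf.mpr fun {q} hq ↦ ?_
  exact (hq.1.1.mem_or_mem (hyx ▸ q.zero_mem)).resolve_right fun h ↦ hx (Set.mem_biUnion hq h)

theorem isGorensteinLocalRing_of_height_eq_zero (hp : p.height = 0) :
    IsGorensteinLocalRing (Localization.AtPrime p) := by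
  have : IsNoetherianRing (Localization.AtPrime p) :=
    IsLocalization.isNoetherianRing p.primeCompl _ inferInstance
  have : Ring.KrullDimLE 0 (Localization.AtPrime p) := by
    rw [Ring.krullDimLE_iff, IsLocalization.AtPrime.ringKrullDim_eq_height p, hp]
    rfl
  have hm : maximalIdeal (Localization.AtPrime p) = ⊥ := by
    rw [← jacobson_eq_maximalIdeal ⊥ bot_ne_top, Ideal.jacobson_bot,
      Ring.jacobson_eq_nilradical_of_krullDimLE_zero, nilradical_eq_zero]
    rfl
  refine .of_subsingleton_ext_residueField (n := 0) fun i hi ↦ ?_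
  obtain ⟨i, rfl⟩ := Nat.exists_eq_succ_of_ne_zero hi.ne'
  have : Subsingleton (ExtMod (Localization.AtPrime p) (Localization.AtPrime p)
    (Localization.AtPrime p) (i + 1)) := ExtMod.subsingleton_of_projective i
  exact ExtMod.subsingleton_of_equiv (Submodule.quotEquivOfEqBot _ hm) (i + 1)

end Reduced

theorem length_le_localRingDepth {R : Type u} [CommRing R] (p : Ideal R) [p.IsPrime] {rs : List R}
    (hrs : RingTheory.Sequence.IsWeaklyRegular R rs) (hmem : ∀ r ∈ rs, r ∈ p) :
    (rs.length : ℕ∞) ≤ localRingDepth (Localization.AtPrime p) := by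
  refine le_iSup₂_of_le (rs.map (algebraMap R (Localization.AtPrime p)))
    ⟨?_, hrs.isRegular_of_isLocalization_of_mem (Localization.AtPrime p) p hmem⟩
    (by rw [List.length_map])
  intro s hs
  obtain ⟨r, hr, rfl⟩ := List.mem_map.mp hs
  exact (IsLocalization.AtPrime.to_map_mem_maximal_iff _ p r).mpr (hmem r hr)

open scoped Pointwise in
/-- For an `R`-algebra `B` and `x : R`, the quotient `B ⧸ xB` does not depend on whether `x` is
taken in `R` or in `B`. -/
def quotSMulTopAlgebraMapEquiv {R : Type*} [CommRing R] (x : R) (B : Type*) [CommRing B]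
    [Algebra R B] : QuotSMulTop x B ≃ₗ[R] QuotSMulTop (algebraMap R B x) B :=
  Submodule.quotEquivOfEq _ ((algebraMap R B x • ⊤ : Submodule B B).restrictScalars R)
    (Submodule.ext fun b ↦ by simp [Submodule.mem_smul_pointwise_iff_exists, Algebra.smul_def]) ≪≫ₗ
    Submodule.Quotient.restrictScalarsEquiv R _

section QuasiNormal

open IsLocalRing

variable {R : Type u} [CommRing R] [IsNoetherianRing R] {n : ℕ}

theorem subsingleton_ext_residueField_of_mem_associatedPrimes [Module.Finite R (Normalization R)]
    (h : HasGDimensionLE R n (ModuleCat.of R (conductorIdeal R))) {x : R}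
    (hx : x ∈ nonZeroDivisors R) {P : Ideal (Normalization R)}
    (hP : P ∈ associatedPrimes (Normalization R)
      (QuotSMulTop (algebraMap R (Normalization R) x) (Normalization R)))
    {p : Ideal R} [p.IsPrime] (hp : P.comap (algebraMap R (Normalization R)) = p) (i : ℕ)
    (hi : n + 1 < i) :
    Subsingleton (ExtMod (Localization.AtPrime p)
      (Localization.AtPrime p ⧸ maximalIdeal (Localization.AtPrime p)) (Localization.AtPrime p)
      i) := by
  have := finite_fractionalConductor (R := R)
  refine subsingleton_ext_residueField_of_comap_eq (A := FractionRing R)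
    (isUnit_algebraMap_normalization hx) hP hp (fractionalConductor R)
    (annihilator_fractionalConductor.trans_le bot_le) (fun j hj ↦ ?_) i hi
  have : Subsingleton (ExtMod R (conductorIdeal R) R j) := h.subsingleton_ext hj
  exact ExtMod.subsingleton_of_equiv (conductorEquiv R).symm j

theorem satisfiesG_one_of_hasGDimensionLE [IsReduced R] [Module.Finite R (Normalization R)]
    (h : HasGDimensionLE R n (ModuleCat.of R (conductorIdeal R))) : SatisfiesG 1 R := by
  intro p _ hp
  by_cases hp0 : p.height = 0
  · exact isGorensteinLocalRing_of_height_eq_zero hp0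
  obtain ⟨x, hxp, hx⟩ := exists_mem_nonZeroDivisors_of_height_ne_zero hp0
  have : IsNoetherianRing (Normalization R) := .of_finite R _
  have : FaithfulSMul R (Normalization R) :=
    (faithfulSMul_iff_algebraMap_injective _ _).mpr (algebraMap_normalization_injective R)
  have : IsNoetherianRing (Localization.AtPrime p) :=
    IsLocalization.isNoetherianRing p.primeCompl _ inferInstance
  obtain ⟨P, hP, hPp⟩ := exists_mem_associatedPrimes_quotSMulTop_comap_eq_of_height_le_one
    (B := Normalization R) hp hxp hx
  exact .of_subsingleton_ext_residueField
    (subsingleton_ext_residueField_of_mem_associatedPrimes h hx hP hPp)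

theorem min_one_height_le_localRingDepth [IsReduced R] (p : Ideal R) [p.IsPrime] :
    min 1 p.height ≤ localRingDepth (Localization.AtPrime p) := by
  by_cases hp : p.height = 0
  · rw [hp, min_eq_right zero_le_one]
    exact zero_le
  obtain ⟨x, hxp, hx⟩ := exists_mem_nonZeroDivisors_of_height_ne_zero hp
  refine (min_le_left _ _).trans (length_le_localRingDepth p (rs := [x]) ?_ (by simpa using hxp))
  simpa using Module.Flat.isSMulRegular_of_nonZeroDivisors hx

variable [IsLocalRing R]

theorem maximalIdeal_mem_associatedPrimes_quotSMulTop_normalization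
    [Module.IsReflexive R (Normalization R)] {x : R} (hx : IsSMulRegular R x)
    (hxm : maximalIdeal R ∈ associatedPrimes R (QuotSMulTop x R))
    (h : IsTotallyReflexive R (conductorIdeal R)) :
    maximalIdeal R ∈ associatedPrimes R (QuotSMulTop x (Normalization R)) := by
  have := finite_normalization_of_isReflexive (R := R)
  have := nontrivial_conductorIdeal (R := R)
  have : Subsingleton (ExtMod R (conductorIdeal R) R 1) := h.ext_eq_zero 1 one_pos
  rw [LinearEquiv.AssociatedPrimes.eq (QuotSMulTop.congr x normalizationEquivDual),
    LinearEquiv.AssociatedPrimes.eq (linearMapQuotSMulTopEquiv hx)]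
  exact maximalIdeal_mem_associatedPrimes_linearMap hxm

theorem height_maximalIdeal_le_one_of_mem_associatedPrimes
    [Module.IsReflexive R (Normalization R)]
    (h : HasGDimensionLE R n (ModuleCat.of R (conductorIdeal R))) {x : R}
    (hx : x ∈ nonZeroDivisors R) (hxm : x ∈ maximalIdeal R)
    (hass : maximalIdeal R ∈ associatedPrimes R (QuotSMulTop x R)) :
    (maximalIdeal R).height ≤ 1 := by
  have := finite_normalization_of_isReflexive (R := R)
  have : IsNoetherianRing (Normalization R) := .of_finite R _
  have hreg : IsSMulRegular R x := Module.Flat.isSMulRegular_of_nonZeroDivisors hx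
  have htr : IsTotallyReflexive R (conductorIdeal R) :=
    h.isTotallyReflexive hreg hass (hreg.of_injective (Submodule.subtype _) Subtype.val_injective)
  have hassB := maximalIdeal_mem_associatedPrimes_quotSMulTop_normalization hreg hass htr
  rw [LinearEquiv.AssociatedPrimes.eq (quotSMulTopAlgebraMapEquiv x (Normalization R))] at hassB
  obtain ⟨P, hP, hPm⟩ := exists_mem_associatedPrimes_comap_eq (B := Normalization R) hassB
  have hext := subsingleton_ext_residueField_of_mem_associatedPrimes (n := 0) htr hx hP hPm
  have hloc : (maximalIdeal (Localization.AtPrime (maximalIdeal R))).height ≤ 1 :=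
    height_maximalIdeal_le_one (Module.Flat.isSMulRegular_of_nonZeroDivisors
        (IsLocalization.map_nonZeroDivisors_le (maximalIdeal R).primeCompl _ ⟨x, hx, rfl⟩))
      ((IsLocalization.AtPrime.to_map_mem_maximal_iff _ _ x).mpr hxm) hext
  rwa [← IsLocalization.height_under (maximalIdeal R).primeCompl,
    IsLocalization.AtPrime.under_maximalIdeal _ (maximalIdeal R)] at hloc

theorem min_two_height_maximalIdeal_le_localRingDepth [IsReduced R]
    [Module.IsReflexive R (Normalization R)]
    (h : HasGDimensionLE R n (ModuleCat.of R (conductorIdeal R))) :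
    min 2 (maximalIdeal R).height ≤ localRingDepth (Localization.AtPrime (maximalIdeal R)) := by
  by_cases hm : (maximalIdeal R).height ≤ 1
  · exact (min_le_right _ _).trans <| (le_min hm le_rfl).trans
      (min_one_height_le_localRingDepth (maximalIdeal R))
  obtain ⟨x, hxm, hx⟩ := exists_mem_nonZeroDivisors_of_height_ne_zero
    (p := maximalIdeal R) fun h0 ↦ hm (h0.trans_le zero_le_one)
  have hreg : IsSMulRegular R x := Module.Flat.isSMulRegular_of_nonZeroDivisors hx
  obtain ⟨y, hym, hy⟩ | hass :=
    exists_isSMulRegular_or_maximalIdeal_mem_associatedPrimes R (QuotSMulTop x R)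
  · refine (min_le_left _ _).trans (length_le_localRingDepth _ (rs := [x, y]) ?_ ?_)
    · simpa using ⟨hreg, hy⟩
    · simpa using ⟨hxm, hym⟩
  · exact absurd (height_maximalIdeal_le_one_of_mem_associatedPrimes h hx hxm hass) hm

theorem height_le_one_of_ne_maximalIdeal {R : Type*} [CommRing R] [IsLocalRing R]
    (hdim : ringKrullDim R ≤ 2) {p : Ideal R} [hp : p.IsPrime] (hpm : p ≠ maximalIdeal R) :
    p.height ≤ 1 := by
  have hm : (maximalIdeal R).height ≤ 2 := by
    rw [← maximalIdeal_height_eq_ringKrullDim] at hdim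
    exact WithBot.coe_le_coe.mp hdim
  have hlt : p < maximalIdeal R := (le_maximalIdeal hp.ne_top).lt_of_ne hpm
  refine (ENat.add_le_add_iff_right ENat.one_ne_top).mp ?_
  exact (Ideal.height_add_one_le_of_lt_of_isPrime hlt).trans (hm.trans_eq one_add_one_eq_two.symm)

theorem satisfiesSerreS_two_of_hasGDimensionLE [IsReduced R]
    [Module.IsReflexive R (Normalization R)] (hdim : ringKrullDim R ≤ 2)
    (h : HasGDimensionLE R n (ModuleCat.of R (conductorIdeal R))) : SatisfiesSerreS 2 R := by
  intro p _
  by_cases hpm : p = maximalIdeal R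
  · subst hpm
    exact min_two_height_maximalIdeal_le_localRingDepth h
  · exact (min_le_right _ _).trans <|
      (le_min (height_le_one_of_ne_maximalIdeal hdim hpm) le_rfl).trans
        (min_one_height_le_localRingDepth p)

end QuasiNormal

theorem mainTheorem7_general (R : Type u) [CommRing R] [IsLocalRing R] [IsNoetherianRing R]
    [IsReduced R] (hdim : ringKrullDim R ≤ 2) (hG : gDimension R (conductorIdeal R) < ⊤)
    (hrefl : Module.IsReflexive R (Normalization R)) : IsQuasiNormal R := by
  obtain ⟨n, hn⟩ := (gDimension_lt_top_iff R _).mp hG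
  have := finite_normalization_of_isReflexive (R := R)
  exact ⟨satisfiesSerreS_two_of_hasGDimensionLE hdim hn, satisfiesG_one_of_hasGDimensionLE hn⟩

theorem mainTheorem7 (R : Type u) [CommRing R] [IsLocalRing R] [IsNoetherianRing R]
    (hR : IsAnalyticallyUnramified R) (hdim : ringKrullDim R = 2)
    (hG : gDimension R (conductorIdeal R) < ⊤)
    (hrefl : Module.IsReflexive R (Normalization R)) :
    IsQuasiNormal R :=
  have := hR.isReduced
  mainTheorem7_general R hdim.le hG hrefl
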